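/- Let $N\ge 1$ and let $z_1,\dots,z_N\ge 0$ be independent random variables (the channel power gains of $N$ diversity branches, not necessarily identically distributed) with distribution functions $F_n(x)=\Pr(z_n\le x)=x^{d_n}l_n(x)$ for $x>0$, where $0<d_n<\infty$ and $l_n:(0,\infty)\to(0,\infty)$ is slowly varying at $0$, i.e. $l_n(tx)/l_n(x)\to 1$ as $x\to0^+$ for every $t>0$. Let the combined gain $z_{\rm c}$ be given by one of $$\text{MRC: } z_{\rm c}=\sum_{n=1}^N z_n,\qquad \text{EGC: } z_{\rm c}=\frac1N\Big(\sum_{n=1}^N\sqrt{z_n}\Big)^2,\qquad \text{SC: } z_{\rm c}=\max_{1\le n\le N} z_n ,$$ let $F_{\rm c}$ be the distribution function of $z_{\rm c}$, and put $d_{\rm c}=\sum_{n=1}^N d_n>0$. Below, $f\sim g$ means $f-g=o(g)$, that is, $f/g\to1$ where $g\ne0$. Then, for each of the three schemes: (i) $F_{\rm c}$ is regularly varying at $0$ with exponent $d_{\rm c}$: $F_{\rm c}(x)>0$ for $x>0$, and $F_{\rm c}(tx)/F_{\rm c}(x)\to t^{d_{\rm c}}$ as $x\to0^+$ for every $t>0$.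 (ii) As $x\to0^+$, $F_{\rm c}(x)\sim\Phi_{\rm c}(x)$, where $$\Phi_{\rm c}(x)=\frac{\prod_{n}\Gamma(d_n+1)}{\Gamma(d_{\rm c}+1)}\prod_{n}F_n(x)\ \text{(MRC)},\qquad \Phi_{\rm c}(x)=\frac{\prod_{n}\Gamma(2d_n+1)}{\Gamma(2d_{\rm c}+1)}\prod_{n}F_n(Nx)\ \text{(EGC)},\qquad \Phi_{\rm c}(x)=\prod_{n}F_n(x)\ \text{(SC)}.$$ For SC this is exact: $F_{\rm c}(x)=\prod_n F_n(x)$ for all real $x$, and this equals $x^{d_{\rm c}}\prod_n l_n(x)$ for $x>0$. (iii) For all constants $\alpha,\beta\in(0,\infty)$, as $\rho\to\infty$, $$\mathrm E\big[\beta e^{-\alpha\rho z_{\rm c}}\big]\sim\beta\,\Gamma(d_{\rm c}+1)\,F_{\rm c}\big(1/(\alpha\rho)\big).$$ (iv) Let $\theta_{\rm t}\in(0,\pi)$ and let $g_1,g_2:(0,\theta_{\rm t})\to[0,\infty)$ be measurable, with $g_1$ bounded and $g_2$ integrable. Then, as $\rho\to\infty$, $$\mathrm E\Big[\int_0^{\theta_{\rm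 t}}g_2(\theta)\exp\Big(-\frac{\rho z_{\rm c}}{g_1(\theta)}\Big)d\theta\Big]\sim\Gamma(d_{\rm c}+1)\Big(\int_0^{\theta_{\rm t}}g_2(\theta)\,g_1(\theta)^{d_{\rm c}}\,d\theta\Big)F_{\rm c}(1/\rho),$$ where the exponential is read as $0$ where $g_1(\theta)=0$. The asymptotic relations (iii) and (iv) also hold with $F_{\rm c}$ replaced by $\Phi_{\rm c}$ on the right-hand side. -/

import Mathlib

open MeasureTheory ProbabilityTheory Filter Topology Asymptotics

noncomputable section

/-- `H : ℝ⁺ → ℝ⁺` has (finite) variation exponent `m` at `0`: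
`H (t x) / H x → t ^ m` as `x → 0⁺`, for every `t > 0`.
It is regularly varying at `0` when `m ≠ 0`, slowly varying when `m = 0`. -/
def HasVariationExponentAtZero (H : ℝ → ℝ) (m : ℝ) : Prop :=
  (∀ x, 0 < x → 0 < H x) ∧
    ∀ t, 0 < t → Tendsto (fun x => H (t * x) / H x) (𝓝[>] 0) (𝓝 (t ^ m))

/-- Slow variation at `0`. -/
def SlowlyVaryingAtZero (H : ℝ → ℝ) : Prop := HasVariationExponentAtZero H 0

/-- The three diversity combining schemes: maximum ratio combining, equal gain combining,
selection combining. -/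
inductive CombiningScheme : Type
  | mrc
  | egc
  | sc

/-- The combined channel power gain, from the power gains of the `N` branches. -/
def CombiningScheme.gain {N : ℕ} : CombiningScheme → (Fin N → ℝ) → ℝ
  | .mrc, x => ∑ n, x n
  | .egc, x => (∑ n, Real.sqrt (x n)) ^ 2 / N
  | .sc, x => ⨆ n, x n

/-- The expression for the CDF of the combined gain near the origin, in terms of the exponents
`d n` and the CDFs `F n` of the branches. -/
def CombiningScheme.cdfNearZero {N : ℕ} (d : Fin N → ℝ) (F : Fin N → ℝ → ℝ) :
    CombiningScheme → ℝ → ℝ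
  | .mrc, x => (Real.Gamma ((∑ n, d n) + 1))⁻¹ * (∏ n, Real.Gamma (d n + 1)) * ∏ n, F n x
  | .egc, x => (Real.Gamma (2 * (∑ n, d n) + 1))⁻¹ * (∏ n, Real.Gamma (2 * d n + 1)) *
      ∏ n, F n (N * x)
  | .sc, x => ∏ n, F n x

/-- The CDF `x ↦ P (X ≤ x)` of a random variable. -/
def rvCDF {Ω : Type*} [MeasurableSpace Ω] (P : Measure Ω) (X : Ω → ℝ) (x : ℝ) : ℝ :=
  cdf (P.map X) x

/-- The combined channel power gain as a random variable. -/
def combinedGain {Ω : Type*} {N : ℕ} (s : CombiningScheme) (z : Fin N → Ω → ℝ) (ω : Ω) : ℝ :=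
  s.gain (fun n => z n ω)

/-- The exponential-mixture error rate `∫₀^θt g₂(θ) exp (-x / g₁(θ)) dθ` at instantaneous SNR `x`.
Where `g₁(θ) = 0` the exponential is `exp (-∞) = 0`. -/
def mixtureErrorRate (θt : ℝ) (g₁ g₂ : ℝ → ℝ) (x : ℝ) : ℝ :=
  ∫ θ in Set.Ioo 0 θt, g₂ θ * (if g₁ θ = 0 then 0 else Real.exp (-(x / g₁ θ)))

end

/-! ### Regular variation at the origin and a Potter bound. -/

section RegularVariation

variable {F G : ℝ → ℝ} {d : ℝ}

/-! Sums of independent gains become products under the Laplace transform, so MRC follows from a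
passage to the transform and back. Abelian direction (`tendsto_integral_exp_div_rvCDF`): `E e^{-sX}
= ∫₀^∞ e^{-u} F(u/s) du`; dividing by `F(1/s)`, the integrand tends to `e^{-u} u^d`, and a Potter
bound dominates it. Hence `E e^{-sX} ~ Γ(d+1) F(1/s)`.

By independence the transform of the sum is asymptotic to `∏ Γ(d_n+1) F_n(1/s)`, and Karamata's
Tauberian theorem (`tendsto_rvCDF_div_of_tendsto_laplace`) returns the CDF: moment convergence plus
Weierstrass approximation gives convergence of integrals of continuous functions, and ramps squeeze
the indicator that represents the CDF.

EGC is the same result for the variables `√z_n`, whose exponents are `2 d_n`, evaluated at `√(N x)`;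
SC is plain independence. Regular variation of `F_c` is then inherited from the explicit formula,
and the error rates come from the Abelian theorem applied to `z_c` itself, with Fubini and dominated
convergence for the mixture. -/

/-- Scaling the argument by a positive constant preserves the filter of right neighbourhoods
of `0`. -/
lemma tendsto_const_mul_nhdsGT_zero {t : ℝ} (ht : 0 < t) :
    Tendsto (fun x : ℝ => t * x) (𝓝[>] 0) (𝓝[>] 0) := by
  refine tendsto_nhdsWithin_iff.2 ⟨?_, ?_⟩
  · have : Tendsto (fun x : ℝ => t * x) (𝓝 0) (𝓝 (t * 0)) := tendsto_id.const_mul t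
    rw [mul_zero] at this
    exact this.mono_left nhdsWithin_le_nhds
  · filter_upwards [self_mem_nhdsWithin] with x hx
    exact mul_pos ht hx

lemma tendsto_one_div_mul_atTop_nhdsGT_zero {a : ℝ} (ha : 0 < a) :
    Tendsto (fun s : ℝ => 1 / (a * s)) atTop (𝓝[>] 0) := by
  simp only [one_div]
  exact tendsto_inv_atTop_nhdsGT_zero.comp (tendsto_id.const_mul_atTop ha)

lemma tendsto_one_div_atTop_nhdsGT_zero :
    Tendsto (fun s : ℝ => 1 / s) atTop (𝓝[>] 0) := by
  simpa using tendsto_one_div_mul_atTop_nhdsGT_zero one_pos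

lemma HasVariationExponentAtZero.eventually_pos (hF : HasVariationExponentAtZero F d) :
    ∀ᶠ x in 𝓝[>] 0, 0 < F x := by
  filter_upwards [self_mem_nhdsWithin] with x hx using hF.1 x hx

lemma isEquivalent_iff_tendsto_div_of_pos {ι : Type*} {u : Filter ι} {f g : ι → ℝ}
    (hg : ∀ᶠ x in u, 0 < g x) : f ~[u] g ↔ Tendsto (fun x => f x / g x) u (𝓝 1) :=
  isEquivalent_iff_tendsto_one (hg.mono fun _ h => h.ne')

lemma HasVariationExponentAtZero.congr (hG : HasVariationExponentAtZero G d)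
    (h : ∀ x, 0 < x → F x = G x) : HasVariationExponentAtZero F d := by
  refine ⟨fun x hx => by rw [h x hx]; exact hG.1 x hx, fun t ht => ?_⟩
  refine (hG.2 t ht).congr' ?_
  filter_upwards [self_mem_nhdsWithin] with x hx
  rw [h x hx, h (t * x) (mul_pos ht hx)]

lemma HasVariationExponentAtZero.of_isEquivalent (hG : HasVariationExponentAtZero G d)
    (hF : ∀ x, 0 < x → 0 < F x) (h : F ~[𝓝[>] 0] G) : HasVariationExponentAtZero F d := by
  refine ⟨hF, fun t ht => ?_⟩
  have h1 := (isEquivalent_iff_tendsto_div_of_pos hG.eventually_pos).1 h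
  have h2 := h1.comp (tendsto_const_mul_nhdsGT_zero ht)
  -- `F(tx)/F(x) = (F(tx)/G(tx)) · (G(tx)/G(x)) · (F(x)/G(x))⁻¹`.
  have h3 := (h2.mul (hG.2 t ht)).mul (h1.inv₀ one_ne_zero)
  simp only [one_mul, inv_one, mul_one] at h3
  refine h3.congr' ?_
  filter_upwards [self_mem_nhdsWithin] with x hx
  have e1 := (hG.1 x hx).ne'
  have e2 := (hG.1 (t * x) (mul_pos ht hx)).ne'
  have e3 := (hF x hx).ne'
  simp only [Function.comp]
  field_simp

lemma HasVariationExponentAtZero.const_mul (hF : HasVariationExponentAtZero F d) {c : ℝ}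
    (hc : 0 < c) : HasVariationExponentAtZero (fun x => c * F x) d := by
  refine ⟨fun x hx => mul_pos hc (hF.1 x hx), fun t ht => ?_⟩
  simpa only [mul_div_mul_left _ _ hc.ne'] using hF.2 t ht

lemma HasVariationExponentAtZero.comp_const_mul (hF : HasVariationExponentAtZero F d) {c : ℝ}
    (hc : 0 < c) : HasVariationExponentAtZero (fun x => F (c * x)) d := by
  refine ⟨fun x hx => hF.1 _ (mul_pos hc hx), fun t ht => ?_⟩
  refine ((hF.2 t ht).comp (tendsto_const_mul_nhdsGT_zero hc)).congr fun x => ?_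
  simp only [Function.comp]
  rw [mul_left_comm]

lemma HasVariationExponentAtZero.comp_sq (hF : HasVariationExponentAtZero F d) :
    HasVariationExponentAtZero (fun x => F (x ^ 2)) (2 * d) := by
  refine ⟨fun x hx => hF.1 _ (pow_pos hx 2), fun t ht => ?_⟩
  have hsq : Tendsto (fun x : ℝ => x ^ 2) (𝓝[>] 0) (𝓝[>] 0) := by
    refine tendsto_nhdsWithin_iff.2 ⟨?_, ?_⟩
    · have : Tendsto (fun x : ℝ => x ^ 2) (𝓝 0) (𝓝 (0 ^ 2)) := tendsto_id.pow 2
      rw [zero_pow two_ne_zero] at this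
      exact this.mono_left nhdsWithin_le_nhds
    · filter_upwards [self_mem_nhdsWithin] with x hx using pow_pos (Set.mem_Ioi.1 hx) 2
  have := (hF.2 (t ^ 2) (pow_pos ht 2)).comp hsq
  rw [Real.rpow_mul ht.le, Real.rpow_two]
  refine this.congr fun x => ?_
  simp only [Function.comp, mul_pow]

lemma HasVariationExponentAtZero.prod {ι : Type*} [Fintype ι] {F : ι → ℝ → ℝ} {d : ι → ℝ}
    (hF : ∀ i, HasVariationExponentAtZero (F i) (d i)) :
    HasVariationExponentAtZero (fun x => ∏ i, F i x) (∑ i, d i) := by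
  refine ⟨fun x hx => Finset.prod_pos fun i _ => (hF i).1 x hx, fun t ht => ?_⟩
  rw [Real.rpow_sum_of_pos ht]
  simp only [← Finset.prod_div_distrib]
  exact tendsto_finsetProd _ fun i _ => (hF i).2 t ht

/-- A slowly varying function times `x ^ d` has variation exponent `d`. -/
lemma SlowlyVaryingAtZero.rpow_mul {l : ℝ → ℝ} (hl : SlowlyVaryingAtZero l) (d : ℝ) :
    HasVariationExponentAtZero (fun x => x ^ d * l x) d := by
  refine ⟨fun x hx => mul_pos (Real.rpow_pos_of_pos hx d) (hl.1 x hx), fun t ht => ?_⟩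
  have := (hl.2 t ht).const_mul (t ^ d)
  rw [Real.rpow_zero, mul_one] at this
  refine this.congr' ?_
  filter_upwards [self_mem_nhdsWithin] with x hx
  have hx : 0 < x := hx
  rw [Real.mul_rpow ht.le hx.le]
  have := (Real.rpow_pos_of_pos hx d).ne'
  have := (hl.1 x hx).ne'
  field_simp

/-- A Potter-type bound for bounded monotone functions of regular variation. -/
lemma HasVariationExponentAtZero.exists_potter_bound (hF : HasVariationExponentAtZero F d)
    (hmono : Monotone F) (hle : ∀ x, F x ≤ 1) :
    ∃ (C : ℝ) (m : ℕ), 0 ≤ C ∧ ∀ᶠ y in 𝓝[>] 0, ∀ u, 1 ≤ u → F (u * y) ≤ C * u ^ m * F y := by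
  -- Any exponent above `d` leaves room for `F(2y) ≤ 2^m F(y)` near `0`; a natural one keeps the
  -- later weight `e^{-u} u^m` simple.
  obtain ⟨m, hm⟩ := exists_nat_gt d
  have hlt : (2 : ℝ) ^ d < 2 ^ m := by
    rw [← Real.rpow_natCast]
    exact Real.rpow_lt_rpow_of_exponent_lt one_lt_two hm
  have hev := (hF.2 2 two_pos).eventually_lt_const hlt
  obtain ⟨δ, hδ, hsub⟩ := mem_nhdsGT_iff_exists_Ioc_subset.1 hev
  have hδ : 0 < δ := hδ
  have hdouble : ∀ y, 0 < y → y ≤ δ → F (2 * y) ≤ 2 ^ m * F y := fun y h0 h1 =>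
    ((div_lt_iff₀ (hF.1 y h0)).1 (hsub ⟨h0, h1⟩)).le
  -- The bound is `2 * δ`, not `δ`, because only the starting point of the last doubling must lie in
  -- `(0, δ]`.
  have hiter : ∀ n : ℕ, ∀ y, 0 < y → 2 ^ n * y ≤ 2 * δ → F (2 ^ n * y) ≤ (2 ^ n) ^ m * F y := by
    intro n
    induction n with
    | zero => intro y _ _; simp
    | succ n ih =>
      intro y hy hn
      rw [pow_succ', mul_assoc] at hn
      have hn' : 2 ^ n * y ≤ δ := by linarith
      calc F (2 ^ (n + 1) * y) = F (2 * (2 ^ n * y)) := by rw [pow_succ', mul_assoc]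
        _ ≤ 2 ^ m * F (2 ^ n * y) := hdouble _ (by positivity) hn'
        _ ≤ 2 ^ m * ((2 ^ n) ^ m * F y) := by
          gcongr
          exact ih y hy (by linarith)
        _ = (2 ^ (n + 1)) ^ m * F y := by rw [pow_succ', mul_pow, mul_assoc]
  have hsmall : ∀ u y, 1 ≤ u → 0 < y → u * y ≤ δ → F (u * y) ≤ 2 ^ m * u ^ m * F y := by
    intro u y hu hy huy
    obtain ⟨n, hn1, hn2⟩ := exists_nat_pow_near hu one_lt_two
    have := (hF.1 y hy).le
    calc F (u * y) ≤ F (2 ^ (n + 1) * y) := hmono (by gcongr)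
      _ ≤ (2 ^ (n + 1)) ^ m * F y := hiter _ y hy (by
          rw [pow_succ', mul_assoc]
          have : 2 ^ n * y ≤ u * y := by gcongr
          linarith)
      _ ≤ (2 * u) ^ m * F y := by
          gcongr
          rw [pow_succ']
          gcongr
      _ = 2 ^ m * u ^ m * F y := by rw [mul_pow]
  have hFδ := hF.1 δ hδ
  -- Dividing by `F δ ≤ 1` extends the bound past `u * y = δ`: there `F(u * y) ≤ 1 = F δ / F δ`, and
  -- `F δ` is controlled by the small range at `u = δ / y`.
  refine ⟨2 ^ m / F δ, m, by positivity, ?_⟩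
  filter_upwards [Ioc_mem_nhdsGT hδ] with y hy u hu
  have hFy := hF.1 y hy.1
  rcases le_total (u * y) δ with h | h
  · refine (hsmall u y hu hy.1 h).trans ?_
    gcongr
    exact le_div_self (by positivity) hFδ (hle δ)
  · have h1 : 1 ≤ δ / y := (one_le_div hy.1).2 hy.2
    have h2 := hsmall (δ / y) y h1 hy.1 (by rw [div_mul_cancel₀ _ hy.1.ne'])
    rw [div_mul_cancel₀ _ hy.1.ne'] at h2
    have h3 : δ / y ≤ u := (div_le_iff₀ hy.1).2 h
    calc F (u * y) ≤ 1 := hle _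
      _ = F δ / F δ := (div_self hFδ.ne').symm
      _ ≤ (2 ^ m * (δ / y) ^ m * F y) / F δ := by gcongr
      _ ≤ (2 ^ m * u ^ m * F y) / F δ := by
        gcongr
      _ = 2 ^ m / F δ * u ^ m * F y := by ring

end RegularVariation

/-! ### Laplace transforms and the Abelian theorem. -/

section Laplace

variable {Ω : Type*} [MeasurableSpace Ω] {P : Measure Ω} {X : Ω → ℝ} {d : ℝ}

lemma monotone_rvCDF : Monotone (rvCDF P X) := monotone_cdf _

lemma rvCDF_le_one (x : ℝ) : rvCDF P X x ≤ 1 := cdf_le_one _ _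

lemma rvCDF_nonneg (x : ℝ) : 0 ≤ rvCDF P X x := cdf_nonneg _ _

variable [IsProbabilityMeasure P]

lemma rvCDF_eq_measureReal (hX : Measurable X) (x : ℝ) :
    rvCDF P X x = P.real {ω | X ω ≤ x} := by
  have := Measure.isProbabilityMeasure_map (μ := P) hX.aemeasurable
  rw [rvCDF, cdf_eq_real, map_measureReal_apply hX measurableSet_Iic]
  rfl

lemma integrable_exp_neg_mul (hX : Measurable X) (h0 : ∀ᵐ ω ∂P, 0 ≤ X ω) {s : ℝ} (hs : 0 ≤ s) :
    Integrable (fun ω => Real.exp (-(s * X ω))) P := by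
  refine Integrable.of_bound (by fun_prop) 1 ?_
  filter_upwards [h0] with ω hω
  rw [Real.norm_eq_abs, Real.abs_exp, Real.exp_le_one_iff]
  exact neg_nonpos.2 (mul_nonneg hs hω)

/-- The Laplace transform of a nonnegative random variable as an integral of its CDF. -/
lemma integral_exp_neg_mul_eq_integral_rvCDF (hX : Measurable X) (h0 : ∀ᵐ ω ∂P, 0 ≤ X ω)
    {s : ℝ} (hs : 0 < s) :
    ∫ ω, Real.exp (-(s * X ω)) ∂P = ∫ u in Set.Ioi 0, Real.exp (-u) * rvCDF P X (u / s) := by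
  have hset : MeasurableSet {p : Ω × ℝ | s * X p.1 ≤ p.2} :=
    measurableSet_le (by fun_prop) (by fun_prop)
  have hint : Integrable (Function.uncurry fun (ω : Ω) (u : ℝ) =>
      {p : Ω × ℝ | s * X p.1 ≤ p.2}.indicator (fun p => Real.exp (-p.2)) (ω, u))
      (P.prod (volume.restrict (Set.Ioi 0))) := by
    have h1 : Integrable (fun p : Ω × ℝ => Real.exp (-p.2))
        (P.prod (volume.restrict (Set.Ioi 0))) :=
      (integrableOn_exp_neg_Ioi 0).integrable.comp_snd P
    exact h1.indicator hset
  have hswap := integral_integral_swap hint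
  calc ∫ ω, Real.exp (-(s * X ω)) ∂P
      = ∫ ω, (∫ u in Set.Ioi 0, {p : Ω × ℝ | s * X p.1 ≤ p.2}.indicator
          (fun p => Real.exp (-p.2)) (ω, u)) ∂P := by
        refine integral_congr_ae ?_
        filter_upwards [h0] with ω hω
        have hnn : 0 ≤ s * X ω := mul_nonneg hs.le hω
        -- `e^{-sX}` is the integral of `e^{-u}` over `u ≥ sX`; the closed half-line matches the
        -- event `X ≤ u / s` of the CDF.
        rw [← integral_exp_neg_Ioi (s * X ω), ← integral_Ici_eq_integral_Ioi,
          ← integral_Ici_eq_integral_Ioi,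
          ← Set.inter_eq_right.2 (Set.Ici_subset_Ici.2 hnn),
          ← setIntegral_indicator measurableSet_Ici]
        rfl
    _ = ∫ u in Set.Ioi 0, (∫ ω, {p : Ω × ℝ | s * X p.1 ≤ p.2}.indicator
          (fun p => Real.exp (-p.2)) (ω, u) ∂P) := hswap
    _ = ∫ u in Set.Ioi 0, Real.exp (-u) * rvCDF P X (u / s) := by
        refine integral_congr_ae (Eventually.of_forall fun u => ?_)
        have hm : MeasurableSet {ω | X ω ≤ u / s} := measurableSet_le hX measurable_const
        have : (fun ω => {p : Ω × ℝ | s * X p.1 ≤ p.2}.indicator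
            (fun p => Real.exp (-p.2)) (ω, u)) =
            {ω | X ω ≤ u / s}.indicator fun _ => Real.exp (-u) := by
          funext ω
          simp only [Set.indicator, Set.mem_ofPred_eq, le_div_iff₀' hs]
        simp only [this]
        rw [integral_indicator_const _ hm, rvCDF_eq_measureReal hX, smul_eq_mul, mul_comm]

/-- **Abelian theorem**: if the CDF of a nonnegative random variable has variation exponent `d`
at `0`, then its Laplace transform at `s` is asymptotic to `Γ(d + 1) F(1 / s)`. -/
theorem tendsto_integral_exp_div_rvCDF (hX : Measurable X) (h0 : ∀ᵐ ω ∂P, 0 ≤ X ω)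
    (hd : 0 < d) (hF : HasVariationExponentAtZero (rvCDF P X) d) :
    Tendsto (fun s => (∫ ω, Real.exp (-(s * X ω)) ∂P) / rvCDF P X (1 / s)) atTop
      (𝓝 (Real.Gamma (d + 1))) := by
  obtain ⟨C, m, hC, hpot⟩ := hF.exists_potter_bound monotone_rvCDF rvCDF_le_one
  have hinv := tendsto_one_div_atTop_nhdsGT_zero
  have hm : IntegrableOn (fun u : ℝ => Real.exp (-u) * u ^ m) (Set.Ioi 0) := by
    have := Real.GammaIntegral_convergent (s := m + 1) (by positivity)
    simpa [Real.rpow_natCast] using this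
  -- The first term covers `u ≤ 1`, by monotonicity of the CDF; the second covers `u ≥ 1`, by the
  -- Potter bound.
  have hbound : IntegrableOn (fun u : ℝ => Real.exp (-u) + C * (Real.exp (-u) * u ^ m))
      (Set.Ioi 0) := (integrableOn_exp_neg_Ioi 0).add (hm.const_mul C)
  have key : Tendsto (fun s => ∫ u in Set.Ioi 0,
      Real.exp (-u) * (rvCDF P X (u * (1 / s)) / rvCDF P X (1 / s))) atTop
      (𝓝 (∫ u in Set.Ioi 0, Real.exp (-u) * u ^ d)) := by
    refine tendsto_integral_filter_of_dominated_convergence _ ?_ ?_ hbound ?_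
    · refine Eventually.of_forall fun s => Measurable.aestronglyMeasurable ?_
      have : Measurable (rvCDF P X) := monotone_rvCDF.measurable
      fun_prop
    · filter_upwards [hinv.eventually hpot, eventually_gt_atTop 0] with s hs hs0
      refine (ae_restrict_iff' measurableSet_Ioi).2 (Eventually.of_forall fun u hu => ?_)
      have hu : 0 < u := hu
      have hpos : 0 < rvCDF P X (1 / s) := hF.1 _ (one_div_pos.2 hs0)
      rw [Real.norm_of_nonneg (mul_nonneg (Real.exp_nonneg _)
        (div_nonneg (rvCDF_nonneg _) hpos.le))]
      have hexp := Real.exp_pos (-u)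
      have : rvCDF P X (u * (1 / s)) / rvCDF P X (1 / s) ≤ 1 + C * u ^ m := by
        rw [div_le_iff₀ hpos]
        rcases le_total u 1 with h | h
        · have h1 : rvCDF P X (u * (1 / s)) ≤ rvCDF P X (1 / s) := by
            apply monotone_rvCDF
            exact mul_le_of_le_one_left (one_div_pos.2 hs0).le h
          have : 0 ≤ C * u ^ m * rvCDF P X (1 / s) := by positivity
          linarith
        · have := hs u h
          linarith
      calc _ ≤ Real.exp (-u) * (1 + C * u ^ m) := by gcongr
        _ = _ := by ring
    · refine (ae_restrict_iff' measurableSet_Ioi).2 (Eventually.of_forall fun u hu => ?_)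
      exact ((hF.2 u hu).comp hinv).const_mul _
  rw [Real.Gamma_eq_integral (by linarith)]
  simp only [add_sub_cancel_right]
  refine key.congr' ?_
  filter_upwards [eventually_gt_atTop 0] with s hs
  rw [integral_exp_neg_mul_eq_integral_rvCDF hX h0 hs, ← integral_div]
  refine integral_congr_ae (Eventually.of_forall fun u => ?_)
  simp only [mul_one_div, mul_div_assoc]

end Laplace

/-! ### From convergence of moments to continuous test functions. -/

section Moments

variable {α β ι : Type*} [MeasurableSpace α] [MeasurableSpace β]

lemma integrable_mul_comp_of_mem_Icc {μ : Measure α} {v V : α → ℝ} (hv : Integrable v μ)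
    (hV : AEMeasurable V μ) (hVI : ∀ᵐ a ∂μ, V a ∈ Set.Icc (0 : ℝ) 1) {f : ℝ → ℝ}
    (hf : Continuous f) : Integrable (fun a => v a * f (V a)) μ := by
  obtain ⟨B, hB⟩ := isCompact_Icc.exists_bound_of_continuousOn (s := Set.Icc (0 : ℝ) 1)
    hf.continuousOn
  refine hv.mul_bdd (c := B) (hf.measurable.comp_aemeasurable hV).aestronglyMeasurable ?_
  filter_upwards [hVI] with a ha using hB _ ha

lemma abs_integral_mul_comp_sub_le {μ : Measure α} {v V : α → ℝ} (hv : Integrable v μ)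
    (hv0 : ∀ᵐ a ∂μ, 0 ≤ v a) (hV : AEMeasurable V μ)
    (hVI : ∀ᵐ a ∂μ, V a ∈ Set.Icc (0 : ℝ) 1) {f g : ℝ → ℝ} (hf : Continuous f)
    (hg : Continuous g) {ε : ℝ} (h : ∀ x ∈ Set.Icc (0 : ℝ) 1, |f x - g x| ≤ ε) :
    |(∫ a, v a * f (V a) ∂μ) - ∫ a, v a * g (V a) ∂μ| ≤ ε * ∫ a, v a ∂μ := by
  rw [← integral_sub (integrable_mul_comp_of_mem_Icc hv hV hVI hf)
    (integrable_mul_comp_of_mem_Icc hv hV hVI hg), ← integral_const_mul, ← Real.norm_eq_abs]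
  refine norm_integral_le_of_norm_le (hv.const_mul ε) ?_
  filter_upwards [hv0, hVI] with a h0 hI
  rw [← mul_sub, Real.norm_eq_abs, abs_mul, abs_of_nonneg h0, mul_comm]
  exact mul_le_mul_of_nonneg_right (h _ hI) h0

/-- Convergence of the weighted moments of variables with values in `[0, 1]` implies convergence
of the weighted integrals of continuous functions. -/
theorem tendsto_integral_mul_comp_of_tendsto_moments {l : Filter ι} {μ : Measure α}
    {v V : ι → α → ℝ} {ν : Measure β} {w W : β → ℝ}
    (hv : ∀ᶠ i in l, Integrable (v i) μ) (hv0 : ∀ᶠ i in l, ∀ᵐ a ∂μ, 0 ≤ v i a)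
    (hV : ∀ᶠ i in l, AEMeasurable (V i) μ)
    (hVI : ∀ᶠ i in l, ∀ᵐ a ∂μ, V i a ∈ Set.Icc (0 : ℝ) 1)
    (hw : Integrable w ν) (hw0 : ∀ᵐ b ∂ν, 0 ≤ w b) (hW : AEMeasurable W ν)
    (hWI : ∀ᵐ b ∂ν, W b ∈ Set.Icc (0 : ℝ) 1)
    (hmom : ∀ k : ℕ, Tendsto (fun i => ∫ a, v i a * V i a ^ k ∂μ) l
      (𝓝 (∫ b, w b * W b ^ k ∂ν))) {f : ℝ → ℝ} (hf : Continuous f) :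
    Tendsto (fun i => ∫ a, v i a * f (V i a) ∂μ) l (𝓝 (∫ b, w b * f (W b) ∂ν)) := by
  have hpoly : ∀ p : Polynomial ℝ, Tendsto (fun i => ∫ a, v i a * p.eval (V i a) ∂μ) l
      (𝓝 (∫ b, w b * p.eval (W b) ∂ν)) := by
    intro p
    induction p using Polynomial.induction_on' with
    | add p q hp hq =>
      have h1 : ∫ b, w b * (p + q).eval (W b) ∂ν =
          (∫ b, w b * p.eval (W b) ∂ν) + ∫ b, w b * q.eval (W b) ∂ν := by
        rw [← integral_add (integrable_mul_comp_of_mem_Icc hw hW hWI p.continuous)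
          (integrable_mul_comp_of_mem_Icc hw hW hWI q.continuous)]
        simp only [Polynomial.eval_add, mul_add]
      rw [h1]
      refine (hp.add hq).congr' ?_
      filter_upwards [hv, hV, hVI] with i hv hV hVI
      rw [← integral_add (integrable_mul_comp_of_mem_Icc hv hV hVI p.continuous)
        (integrable_mul_comp_of_mem_Icc hv hV hVI q.continuous)]
      simp only [Polynomial.eval_add, mul_add]
    | monomial n c =>
      simp only [Polynomial.eval_monomial, mul_left_comm _ c, integral_const_mul]
      exact (hmom n).const_mul c
  rw [Metric.tendsto_nhds]
  intro ε hε
  -- The zeroth moment keeps the masses eventually below `M`, so a polynomial within `ε / (3M)`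
  -- costs at most `ε / 3` on each side.
  set M := (∫ b, w b ∂ν) + 1 with hM
  have hM0 : 0 < M := by
    have : 0 ≤ ∫ b, w b ∂ν := integral_nonneg_of_ae hw0
    linarith
  have hmass : ∀ᶠ i in l, ∫ a, v i a ∂μ < M := by
    have := hmom 0
    simp only [pow_zero, mul_one] at this
    exact this.eventually_lt_const (by linarith)
  have hε' : 0 < ε / (3 * M) := by positivity
  obtain ⟨p, hp⟩ := exists_polynomial_near_of_continuousOn 0 1 f hf.continuousOn _ hε'
  have hεM : ε / (3 * M) * M = ε / 3 := by field_simp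
  have hW' := abs_integral_mul_comp_sub_le hw hw0 hW hWI p.continuous hf
    fun x hx => (hp x hx).le
  have hW'' : ε / (3 * M) * ∫ b, w b ∂ν ≤ ε / 3 := by
    rw [← hεM]
    gcongr
    linarith
  filter_upwards [hv, hv0, hV, hVI, hmass,
    Metric.tendsto_nhds.1 (hpoly p) (ε / 3) (by positivity)] with i hv hv0 hV hVI hm hd
  have h1 := abs_integral_mul_comp_sub_le hv hv0 hV hVI p.continuous hf
    fun x hx => (hp x hx).le
  have h2 : ε / (3 * M) * ∫ a, v i a ∂μ < ε / 3 := by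
    rw [← hεM]
    gcongr
  rw [Real.dist_eq] at hd ⊢
  rw [abs_le] at h1 hW'
  rw [abs_lt] at hd ⊢
  constructor <;> linarith

end Moments

/-! ### Continuous approximations of indicators. -/

section Ramp

/-- A continuous function `k` such that `x * k x` interpolates between the indicators of
`[b, ∞)` and `[a, ∞)`. -/
noncomputable def rampKernel (a b x : ℝ) : ℝ :=
  max 0 (min 1 ((x - a) / (b - a))) / max x a

variable {a b x : ℝ}

/-- The denominator `max x a` avoids the singularity at `0` and equals `x` wherever the numerator is
nonzero. The division is there because the Tauberian weight already carries one factor `x =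
e^{-sX}`. -/
lemma continuous_rampKernel (ha : 0 < a) : Continuous (rampKernel a b) := by
  unfold rampKernel
  refine Continuous.div (by fun_prop) (by fun_prop) fun x => ?_
  exact (ha.trans_le (le_max_right _ _)).ne'

lemma mul_rampKernel_le (ha : 0 < a) (hab : a < b) :
    x * rampKernel a b x ≤ (Set.Ici a).indicator 1 x := by
  unfold rampKernel
  rcases le_or_gt a x with h | h
  · rw [Set.indicator_of_mem (Set.mem_Ici.2 h), max_eq_left h,
      mul_div_cancel₀ _ (ha.trans_le h).ne']
    exact max_le zero_le_one (min_le_left _ _)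
  · have : (x - a) / (b - a) ≤ 0 := div_nonpos_of_nonpos_of_nonneg (by linarith) (by linarith)
    rw [max_eq_left ((min_le_right _ _).trans this), zero_div, mul_zero]
    exact Set.indicator_nonneg (fun _ _ => zero_le_one) _

lemma le_mul_rampKernel (ha : 0 < a) (hab : a < b) (hx : 0 ≤ x) :
    (Set.Ici b).indicator 1 x ≤ x * rampKernel a b x := by
  have h0 : 0 ≤ x * rampKernel a b x :=
    mul_nonneg hx (div_nonneg (le_max_left _ _) (ha.le.trans (le_max_right _ _)))
  rcases le_or_gt b x with h | h
  · have hax := hab.trans_le h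
    have : 1 ≤ (x - a) / (b - a) := (one_le_div (by linarith)).2 (by linarith)
    rw [Set.indicator_of_mem (Set.mem_Ici.2 h), rampKernel, min_eq_left this,
      max_eq_right zero_le_one, max_eq_left hax.le, mul_div_cancel₀ _ (ha.trans hax).ne']
    rfl
  · rwa [Set.indicator_of_notMem (by simpa using h)]

end Ramp

/-! ### Karamata's Tauberian theorem. -/

section Tauberian

variable {Ω : Type*} [MeasurableSpace Ω] {P : Measure Ω} [IsProbabilityMeasure P]
  {X : Ω → ℝ} {d : ℝ}

/-- `e^{-t} ≥ e^{-c}` means `t ≤ c`, so this is the mass `∫₀^c d t^{d-1} dt` that the limit measure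
gives to `(0, c]`. -/
lemma integral_indicator_exp_rpow (hd : 0 < d) {c : ℝ} (hc : 0 < c) :
    IntegrableOn (fun t : ℝ => (Set.Ici (Real.exp (-c))).indicator (1 : ℝ → ℝ) (Real.exp (-t)) *
      (d * t ^ (d - 1))) (Set.Ioi 0) ∧
    ∫ t in Set.Ioi 0, (Set.Ici (Real.exp (-c))).indicator (1 : ℝ → ℝ) (Real.exp (-t)) *
      (d * t ^ (d - 1)) = c ^ d := by
  have h1 : (fun t : ℝ => (Set.Ici (Real.exp (-c))).indicator (1 : ℝ → ℝ) (Real.exp (-t)) *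
      (d * t ^ (d - 1))) = (Set.Iic c).indicator fun t => d * t ^ (d - 1) := by
    funext t
    simp only [Set.indicator, Set.mem_Ici, Set.mem_Iic, Real.exp_le_exp, neg_le_neg_iff,
      Pi.one_apply, ite_mul, one_mul, zero_mul]
  have hint : IntegrableOn (fun t : ℝ => d * t ^ (d - 1)) (Set.Ioc 0 c) := by
    rw [← intervalIntegrable_iff_integrableOn_Ioc_of_le hc.le]
    exact (intervalIntegral.intervalIntegrable_rpow' (by linarith)).const_mul d
  rw [h1]
  constructor
  · rw [IntegrableOn, integrable_indicator_iff measurableSet_Iic, IntegrableOn,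
      Measure.restrict_restrict measurableSet_Iic, Set.inter_comm, Set.Ioi_inter_Iic]
    exact hint
  · rw [setIntegral_indicator measurableSet_Iic, Set.Ioi_inter_Iic,
      ← intervalIntegral.integral_of_le hc.le, intervalIntegral.integral_const_mul,
      integral_rpow (Or.inl (by linarith)), sub_add_cancel, Real.zero_rpow hd.ne']
    field_simp
    ring

/-- **Karamata's Tauberian theorem** at the origin: the behaviour of the Laplace transform of a
nonnegative random variable at infinity determines its CDF near `0`. -/
theorem tendsto_rvCDF_div_of_tendsto_laplace (hX : Measurable X) (h0 : ∀ᵐ ω ∂P, 0 ≤ X ω)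
    (hd : 0 < d) {φ : ℝ → ℝ} (hφ : ∀ᶠ s in atTop, 0 < φ s)
    (hL : ∀ k : ℕ, Tendsto
      (fun s => (∫ ω, Real.exp (-((k + 1) * s * X ω)) ∂P) / φ s) atTop
      (𝓝 (Real.Gamma (d + 1) * (1 / (k + 1)) ^ d))) :
    Tendsto (fun s => rvCDF P X (1 / s) / φ s) atTop (𝓝 1) := by
  -- Density of the limit measure `d(t^d)` of the rescaled law of `sX`, damped by `e^{-t}` to have
  -- finite mass.
  set w : ℝ → ℝ := fun t => Real.exp (-t) * (d * t ^ (d - 1)) with hwdef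
  have hw : IntegrableOn w (Set.Ioi 0) := by
    have := (Real.GammaIntegral_convergent hd).const_mul d
    refine Integrable.congr this (Eventually.of_forall fun t => ?_)
    simp only [hwdef]
    ring
  have hv : ∀ᶠ s in atTop, Integrable (fun ω => Real.exp (-(s * X ω)) / φ s) P := by
    filter_upwards [eventually_ge_atTop 0] with s hs
    exact (integrable_exp_neg_mul hX h0 hs).div_const _
  have hWI : ∀ᵐ t ∂volume.restrict (Set.Ioi (0 : ℝ)), Real.exp (-t) ∈ Set.Icc (0 : ℝ) 1 := by
    refine (ae_restrict_iff' measurableSet_Ioi).2 (Eventually.of_forall fun t ht => ?_)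
    exact ⟨Real.exp_nonneg _, Real.exp_le_one_iff.2 (neg_nonpos.2 (le_of_lt ht))⟩
  have hconv : ∀ {f : ℝ → ℝ}, Continuous f → Tendsto
      (fun s => ∫ ω, Real.exp (-(s * X ω)) / φ s * f (Real.exp (-(s * X ω))) ∂P) atTop
      (𝓝 (∫ t in Set.Ioi 0, w t * f (Real.exp (-t)))) := by
    intro f hf
    refine tendsto_integral_mul_comp_of_tendsto_moments
      (v := fun s ω => Real.exp (-(s * X ω)) / φ s) (V := fun s ω => Real.exp (-(s * X ω)))
      (W := fun t => Real.exp (-t)) hv ?_ ?_ ?_ hw ?_ (by fun_prop) hWI ?_ hf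
    · filter_upwards [hφ] with s hs
      exact Eventually.of_forall fun ω => by positivity
    · exact Eventually.of_forall fun s => by fun_prop
    · filter_upwards [eventually_ge_atTop 0] with s hs
      filter_upwards [h0] with ω hω
      exact ⟨Real.exp_nonneg _, Real.exp_le_one_iff.2 (neg_nonpos.2 (mul_nonneg hs hω))⟩
    · refine (ae_restrict_iff' measurableSet_Ioi).2 (Eventually.of_forall fun t ht => ?_)
      have ht : 0 < t := ht
      positivity
    · intro k
      have hk : (0 : ℝ) < k + 1 := by positivity
      -- The weight supplies one factor `e^{-t}` and the moment `k` more, which is why the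
      -- hypothesis samples the transform at `(k + 1) s`.
      have e1 : ∫ t in Set.Ioi 0, w t * Real.exp (-t) ^ k =
          Real.Gamma (d + 1) * (1 / (k + 1)) ^ d := by
        rw [Real.Gamma_add_one hd.ne', mul_assoc, mul_comm (Real.Gamma d),
          ← Real.integral_rpow_mul_exp_neg_mul_Ioi hd hk, ← integral_const_mul]
        refine integral_congr_ae (Eventually.of_forall fun t => ?_)
        have : Real.exp (-((k + 1) * t)) = Real.exp (-t) * Real.exp (-t) ^ k := by
          rw [← Real.exp_nat_mul, ← Real.exp_add]
          ring_nf
        simp only [hwdef, this]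
        ring
      rw [e1]
      refine (hL k).congr fun s => ?_
      rw [← integral_div]
      refine integral_congr_ae (Eventually.of_forall fun ω => ?_)
      have : Real.exp (-((k + 1) * s * X ω)) =
          Real.exp (-(s * X ω)) * Real.exp (-(s * X ω)) ^ k := by
        rw [← Real.exp_nat_mul, ← Real.exp_add]
        ring_nf
      simp only [this]
      ring
  have hcdf : ∀ {s : ℝ}, 0 < s →
      Integrable (fun ω => (Set.Ici (Real.exp (-1))).indicator (1 : ℝ → ℝ)
        (Real.exp (-(s * X ω))) / φ s) P ∧
      ∫ ω, (Set.Ici (Real.exp (-1))).indicator (1 : ℝ → ℝ) (Real.exp (-(s * X ω))) / φ s ∂P =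
        rvCDF P X (1 / s) / φ s := by
    intro s hs
    have hm : MeasurableSet {ω | X ω ≤ 1 / s} := measurableSet_le hX measurable_const
    have : (fun ω => (Set.Ici (Real.exp (-1))).indicator (1 : ℝ → ℝ) (Real.exp (-(s * X ω)))) =
        {ω | X ω ≤ 1 / s}.indicator 1 := by
      funext ω
      simp only [Set.indicator, Set.mem_Ici, Real.exp_le_exp, neg_le_neg_iff,
        Set.mem_ofPred_eq, le_div_iff₀' hs, Pi.one_apply]
    refine ⟨Integrable.div_const ?_ _, ?_⟩
    · rw [this]
      exact (integrable_const 1).indicator hm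
    · rw [integral_div, this, integral_indicator_one hm, rvCDF_eq_measureReal hX]
  have hpow : Tendsto (fun c : ℝ => c ^ d) (𝓝 1) (𝓝 1) := by
    have := (Real.continuousAt_rpow_const 1 d (Or.inl one_ne_zero)).tendsto
    rwa [Real.one_rpow] at this
  have hPint : ∀ {f : ℝ → ℝ}, Continuous f → ∀ {s : ℝ}, 0 < s →
      Integrable (fun ω => Real.exp (-(s * X ω)) / φ s * f (Real.exp (-(s * X ω)))) P := by
    intro f hf s hs
    refine integrable_mul_comp_of_mem_Icc ((integrable_exp_neg_mul hX h0 hs.le).div_const _)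
      (by fun_prop) ?_ hf
    filter_upwards [h0] with ω hω
    exact ⟨Real.exp_nonneg _, Real.exp_le_one_iff.2 (neg_nonpos.2 (mul_nonneg hs.le hω))⟩
  have hwint : ∀ {f : ℝ → ℝ}, Continuous f →
      IntegrableOn (fun t => w t * f (Real.exp (-t))) (Set.Ioi 0) := fun hf =>
    integrable_mul_comp_of_mem_Icc hw (by fun_prop) hWI hf
  rw [tendsto_order]
  constructor
  · intro y hy
    -- With `c < 1` the ramp from `e^{-1}` to `e^{-c}` lies below the indicator of `sX ≤ 1`, while
    -- its limit integral is at least `c^d > y`.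
    obtain ⟨c, hcy, hc1, hc0⟩ := (((hpow.eventually_const_lt hy).filter_mono
      nhdsWithin_le_nhds).and (Ioo_mem_nhdsLT (zero_lt_one (α := ℝ)))).exists
    have hab : Real.exp (-1) < Real.exp (-c) := Real.exp_lt_exp.2 (by linarith)
    have hk := continuous_rampKernel (b := Real.exp (-c)) (Real.exp_pos (-1))
    have hlim := hconv hk
    obtain ⟨i1, i2⟩ := integral_indicator_exp_rpow hd hc1
    have hlow : c ^ d ≤ ∫ t in Set.Ioi 0,
        w t * rampKernel (Real.exp (-1)) (Real.exp (-c)) (Real.exp (-t)) := by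
      rw [← i2]
      refine setIntegral_mono_on i1 (hwint hk) measurableSet_Ioi fun t ht => ?_
      have ht : 0 < t := ht
      have := le_mul_rampKernel (Real.exp_pos (-1)) hab (Real.exp_nonneg (-t))
      calc _ ≤ Real.exp (-t) * rampKernel (Real.exp (-1)) (Real.exp (-c)) (Real.exp (-t)) *
            (d * t ^ (d - 1)) := by gcongr
        _ = _ := by simp only [hwdef]; ring
    filter_upwards [hlim.eventually_const_lt (hcy.trans_le hlow), eventually_gt_atTop 0, hφ]
      with s hs hs0 hφs
    refine hs.trans_le ?_
    rw [← (hcdf hs0).2]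
    refine integral_mono (hPint hk hs0) (hcdf hs0).1 fun ω => ?_
    have := mul_rampKernel_le (x := Real.exp (-(s * X ω))) (Real.exp_pos (-1)) hab
    calc _ = Real.exp (-(s * X ω)) *
          rampKernel (Real.exp (-1)) (Real.exp (-c)) (Real.exp (-(s * X ω))) / φ s := by ring
      _ ≤ _ := by gcongr
  · intro y hy
    -- Symmetrically, `c > 1` puts the ramp above the indicator, with limit integral at most `c^d <
    -- y`.
    obtain ⟨c, hcy, hc1⟩ := (((hpow.eventually_lt_const hy).filter_mono
      nhdsWithin_le_nhds).and (self_mem_nhdsWithin (s := Set.Ioi (1 : ℝ)))).exists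
    have hc1 : 1 < c := hc1
    have hab : Real.exp (-c) < Real.exp (-1) := Real.exp_lt_exp.2 (by linarith)
    have hk := continuous_rampKernel (b := Real.exp (-1)) (Real.exp_pos (-c))
    have hlim := hconv hk
    obtain ⟨i1, i2⟩ := integral_indicator_exp_rpow hd (zero_lt_one.trans hc1)
    have hupp : ∫ t in Set.Ioi 0,
        w t * rampKernel (Real.exp (-c)) (Real.exp (-1)) (Real.exp (-t)) ≤ c ^ d := by
      rw [← i2]
      refine setIntegral_mono_on (hwint hk) i1 measurableSet_Ioi fun t ht => ?_
      have ht : 0 < t := ht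
      have := mul_rampKernel_le (x := Real.exp (-t)) (Real.exp_pos (-c)) hab
      calc _ = Real.exp (-t) * rampKernel (Real.exp (-c)) (Real.exp (-1)) (Real.exp (-t)) *
            (d * t ^ (d - 1)) := by simp only [hwdef]; ring
        _ ≤ _ := by gcongr
    filter_upwards [hlim.eventually_lt_const (hupp.trans_lt hcy), eventually_gt_atTop 0, hφ]
      with s hs hs0 hφs
    refine lt_of_le_of_lt ?_ hs
    rw [← (hcdf hs0).2]
    refine integral_mono (hcdf hs0).1 (hPint hk hs0) fun ω => ?_
    have := le_mul_rampKernel (Real.exp_pos (-c)) hab (Real.exp_nonneg (-(s * X ω)))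
    calc _ ≤ Real.exp (-(s * X ω)) *
          rampKernel (Real.exp (-c)) (Real.exp (-1)) (Real.exp (-(s * X ω))) / φ s := by gcongr
      _ = _ := by ring

end Tauberian

/-! ### Asymptotics of average error rates. -/

section ErrorRate

variable {Ω : Type*} [MeasurableSpace Ω] {P : Measure Ω} [IsProbabilityMeasure P]
  {X : Ω → ℝ} {d : ℝ}

/-- The Abelian theorem at `s / g` gives `Γ(d+1) F(g/s)`, and regular variation trades `F(g/s)` for
`g^d F(1/s)`. It feeds both the mixture limit and, with `g = 1/(k+1)`, the Tauberian hypothesis. -/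
lemma tendsto_integral_exp_div_mul_div_rvCDF (hX : Measurable X) (h0 : ∀ᵐ ω ∂P, 0 ≤ X ω)
    (hd : 0 < d) (hF : HasVariationExponentAtZero (rvCDF P X) d) {g : ℝ} (hg : 0 < g) :
    Tendsto (fun s => (∫ ω, Real.exp (-(s / g * X ω)) ∂P) / rvCDF P X (1 / s)) atTop
      (𝓝 (Real.Gamma (d + 1) * g ^ d)) := by
  have h1 := (tendsto_integral_exp_div_rvCDF hX h0 hd hF).comp (tendsto_id.atTop_div_const hg)
  have h2 := (hF.2 g hg).comp tendsto_one_div_atTop_nhdsGT_zero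
  refine (h1.mul h2).congr' ?_
  filter_upwards [eventually_gt_atTop 0] with s hs
  simp only [Function.comp, id, one_div_div, mul_one_div]
  exact div_mul_div_cancel₀ (hF.1 _ (div_pos hg hs)).ne'

/-- The average of an exponential error rate. -/
theorem isEquivalent_integral_exp (hX : Measurable X) (h0 : ∀ᵐ ω ∂P, 0 ≤ X ω)
    (hd : 0 < d) (hF : HasVariationExponentAtZero (rvCDF P X) d) {α β : ℝ} (hα : 0 < α) :
    (fun ρ : ℝ => ∫ ω, β * Real.exp (-(α * ρ * X ω)) ∂P) ~[atTop]
      fun ρ => β * Real.Gamma (d + 1) * rvCDF P X (1 / (α * ρ)) := by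
  have hΓ : 0 < Real.Gamma (d + 1) := Real.Gamma_pos_of_pos (by linarith)
  have h1 : (fun s : ℝ => ∫ ω, Real.exp (-(s * X ω)) ∂P) ~[atTop]
      fun s => Real.Gamma (d + 1) * rvCDF P X (1 / s) := by
    have hev := tendsto_one_div_atTop_nhdsGT_zero.eventually hF.eventually_pos
    rw [isEquivalent_iff_tendsto_div_of_pos (hev.mono fun s hs => mul_pos hΓ hs)]
    have := (tendsto_integral_exp_div_rvCDF hX h0 hd hF).div_const (Real.Gamma (d + 1))
    rw [div_self hΓ.ne'] at this
    refine this.congr fun s => ?_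
    rw [div_div, mul_comm]
  have h2 := h1.comp_tendsto (tendsto_id.const_mul_atTop hα)
  simp only [integral_const_mul, mul_assoc β]
  exact (IsEquivalent.refl (u := fun _ : ℝ => β)).mul h2

/-- The kernel `exp (-x / g)`, read as `0` at `g = 0`. -/
noncomputable def expDivKernel (x g : ℝ) : ℝ := if g = 0 then 0 else Real.exp (-(x / g))

lemma measurable_expDivKernel : Measurable fun p : ℝ × ℝ => expDivKernel p.1 p.2 := by
  refine Measurable.ite (measurable_snd (measurableSet_singleton 0)) measurable_const ?_
  fun_prop

lemma expDivKernel_nonneg (x g : ℝ) : 0 ≤ expDivKernel x g := by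
  unfold expDivKernel
  split_ifs
  exacts [le_rfl, Real.exp_nonneg _]

lemma expDivKernel_le_exp {x g M : ℝ} (hx : 0 ≤ x) (hg : 0 ≤ g) (hgM : g ≤ M) :
    expDivKernel x g ≤ Real.exp (-(x / M)) := by
  unfold expDivKernel
  split_ifs with h
  · exact Real.exp_nonneg _
  · have : 0 < g := lt_of_le_of_ne hg (Ne.symm h)
    gcongr

lemma expDivKernel_le_one {x g : ℝ} (hx : 0 ≤ x) (hg : 0 ≤ g) : expDivKernel x g ≤ 1 :=
  (expDivKernel_le_exp hx hg le_rfl).trans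
    (Real.exp_le_one_iff.2 (neg_nonpos.2 (div_nonneg hx hg)))

lemma integrable_expDivKernel (hX : Measurable X) (h0 : ∀ᵐ ω ∂P, 0 ≤ X ω) {ρ g : ℝ}
    (hρ : 0 ≤ ρ) (hg : 0 ≤ g) : Integrable (fun ω => expDivKernel (ρ * X ω) g) P := by
  refine Integrable.of_bound (C := 1) (Measurable.aestronglyMeasurable ?_) ?_
  · exact measurable_expDivKernel.comp ((hX.const_mul ρ).prodMk measurable_const)
  · filter_upwards [h0] with ω hω
    rw [Real.norm_of_nonneg (expDivKernel_nonneg _ _)]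
    exact expDivKernel_le_one (mul_nonneg hρ hω) hg

variable {T : Type*} [MeasurableSpace T] {ν : Measure T} [SFinite ν] {g₁ g₂ : T → ℝ}

/-- Fubini for an exponential mixture. -/
lemma integral_integral_expDivKernel_swap (hX : Measurable X) (h0 : ∀ᵐ ω ∂P, 0 ≤ X ω)
    (hg₁ : AEMeasurable g₁ ν) (hg₁0 : ∀ᵐ θ ∂ν, 0 ≤ g₁ θ) (hg₂ : Integrable g₂ ν) {ρ : ℝ}
    (hρ : 0 ≤ ρ) :
    ∫ ω, (∫ θ, g₂ θ * expDivKernel (ρ * X ω) (g₁ θ) ∂ν) ∂P =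
      ∫ θ, g₂ θ * (∫ ω, expDivKernel (ρ * X ω) (g₁ θ) ∂P) ∂ν := by
  have hint : Integrable (Function.uncurry fun (ω : Ω) (θ : T) =>
      g₂ θ * expDivKernel (ρ * X ω) (g₁ θ)) (P.prod ν) := by
    refine Integrable.mul_bdd (c := 1) (hg₂.comp_snd P) ?_ ?_
    · refine AEMeasurable.aestronglyMeasurable (measurable_expDivKernel.comp_aemeasurable
        (f := fun p : Ω × T => (ρ * X p.1, g₁ p.2)) ?_)
      exact AEMeasurable.prodMk (by fun_prop) hg₁.comp_snd
    · have e1 : ∀ᵐ p ∂P.prod ν, 0 ≤ X p.1 := Measure.quasiMeasurePreserving_fst.ae h0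
      have e2 : ∀ᵐ p ∂P.prod ν, 0 ≤ g₁ p.2 := Measure.quasiMeasurePreserving_snd.ae hg₁0
      filter_upwards [e1, e2] with p h1 h2
      rw [Real.norm_of_nonneg (expDivKernel_nonneg _ _)]
      exact expDivKernel_le_one (mul_nonneg hρ h1) h2
  rw [integral_integral_swap hint]
  simp only [integral_const_mul]

/-- After Fubini, the limit is taken pointwise in `θ`. The kernel increases with `g`, so the ratio
at `g₁ θ` is at most the ratio at `M`, which converges and is eventually below its limit plus one.
-/
theorem tendsto_integral_mixture_div_rvCDF (hX : Measurable X) (h0 : ∀ᵐ ω ∂P, 0 ≤ X ω)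
    (hd : 0 < d) (hF : HasVariationExponentAtZero (rvCDF P X) d)
    (hg₁ : AEMeasurable g₁ ν) (hg₁0 : ∀ᵐ θ ∂ν, 0 ≤ g₁ θ) {M : ℝ} (hM : 0 < M)
    (hg₁M : ∀ᵐ θ ∂ν, g₁ θ ≤ M) (hg₂ : Integrable g₂ ν) :
    Tendsto (fun ρ : ℝ => (∫ ω, (∫ θ, g₂ θ * expDivKernel (ρ * X ω) (g₁ θ) ∂ν) ∂P) /
      rvCDF P X (1 / ρ)) atTop
      (𝓝 (Real.Gamma (d + 1) * ∫ θ, g₂ θ * g₁ θ ^ d ∂ν)) := by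
  have hlap : ∀ {g : ℝ}, g ≠ 0 → ∀ ρ : ℝ, ∫ ω, expDivKernel (ρ * X ω) g ∂P =
      ∫ ω, Real.exp (-(ρ / g * X ω)) ∂P := by
    intro g hg ρ
    simp only [expDivKernel, hg, if_false, div_mul_eq_mul_div]
  have key : Tendsto (fun ρ : ℝ => ∫ θ, g₂ θ *
      ((∫ ω, expDivKernel (ρ * X ω) (g₁ θ) ∂P) / rvCDF P X (1 / ρ)) ∂ν) atTop
      (𝓝 (∫ θ, g₂ θ * (Real.Gamma (d + 1) * g₁ θ ^ d) ∂ν)) := by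
    have hlim := tendsto_integral_exp_div_mul_div_rvCDF hX h0 hd hF hM
    refine tendsto_integral_filter_of_dominated_convergence
      (fun θ => ‖g₂ θ‖ * (Real.Gamma (d + 1) * M ^ d + 1)) ?_ ?_ (hg₂.norm.mul_const _) ?_
    · refine Eventually.of_forall fun ρ => hg₂.aestronglyMeasurable.mul ?_
      have hm : Measurable fun p : Ω × ℝ => expDivKernel (ρ * X p.1) p.2 :=
        measurable_expDivKernel.comp (by fun_prop : Measurable fun p : Ω × ℝ => (ρ * X p.1, p.2))
      have := hm.stronglyMeasurable.integral_prod_left' (μ := P)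
      exact ((this.measurable.div_const _).comp_aemeasurable hg₁).aestronglyMeasurable
    · filter_upwards [hlim.eventually_lt_const (lt_add_one _), eventually_gt_atTop 0]
        with ρ hρ hρ0
      filter_upwards [hg₁0, hg₁M] with θ h1 h2
      have hpos : 0 < rvCDF P X (1 / ρ) := hF.1 _ (one_div_pos.2 hρ0)
      rw [norm_mul]
      gcongr
      rw [Real.norm_of_nonneg (div_nonneg
        (integral_nonneg fun ω => expDivKernel_nonneg _ _) hpos.le)]
      refine le_trans ?_ hρ.le
      refine div_le_div_of_nonneg_right ?_ hpos.le
      refine integral_mono_ae (integrable_expDivKernel hX h0 hρ0.le h1)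
        (integrable_exp_neg_mul hX h0 (div_pos hρ0 hM).le) ?_
      filter_upwards [h0] with ω hω
      rw [div_mul_eq_mul_div]
      exact expDivKernel_le_exp (mul_nonneg hρ0.le hω) h1 h2
    · filter_upwards [hg₁0] with θ hθ
      refine Tendsto.const_mul _ ?_
      rcases hθ.eq_or_lt with h | h
      · simp [← h, expDivKernel, Real.zero_rpow hd.ne']
      · simp only [hlap h.ne']
        exact tendsto_integral_exp_div_mul_div_rvCDF hX h0 hd hF h
  have e : ∫ θ, g₂ θ * (Real.Gamma (d + 1) * g₁ θ ^ d) ∂ν =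
      Real.Gamma (d + 1) * ∫ θ, g₂ θ * g₁ θ ^ d ∂ν := by
    simp only [mul_left_comm _ (Real.Gamma (d + 1)), integral_const_mul]
  rw [← e]
  refine key.congr' ?_
  filter_upwards [eventually_ge_atTop 0] with ρ hρ
  rw [integral_integral_expDivKernel_swap hX h0 hg₁ hg₁0 hg₂ hρ, ← integral_div]
  simp only [mul_div_assoc]

/-- The average of an exponential-mixture error rate. -/
theorem isEquivalent_integral_mixture (hX : Measurable X) (h0 : ∀ᵐ ω ∂P, 0 ≤ X ω)
    (hd : 0 < d) (hF : HasVariationExponentAtZero (rvCDF P X) d)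
    (hg₁ : AEMeasurable g₁ ν) (hg₁0 : ∀ᵐ θ ∂ν, 0 ≤ g₁ θ) {M : ℝ} (hM : 0 < M)
    (hg₁M : ∀ᵐ θ ∂ν, g₁ θ ≤ M) (hg₂ : Integrable g₂ ν) (hg₂0 : ∀ᵐ θ ∂ν, 0 ≤ g₂ θ) :
    (fun ρ : ℝ => ∫ ω, (∫ θ, g₂ θ * expDivKernel (ρ * X ω) (g₁ θ) ∂ν) ∂P) ~[atTop]
      fun ρ => Real.Gamma (d + 1) * (∫ θ, g₂ θ * g₁ θ ^ d ∂ν) * rvCDF P X (1 / ρ) := by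
  have hΓ : 0 < Real.Gamma (d + 1) := Real.Gamma_pos_of_pos (by linarith)
  have hnn : 0 ≤ᵐ[ν] fun θ => g₂ θ * g₁ θ ^ d := by
    filter_upwards [hg₁0, hg₂0] with θ h1 h2 using mul_nonneg h2 (Real.rpow_nonneg h1 d)
  rcases (integral_nonneg_of_ae hnn).eq_or_lt with hI | hI
  -- When the constant vanishes no ratio is available; but then `g₂` or `g₁` is zero almost
  -- everywhere, and both sides are identically `0`.
  · have hint : Integrable (fun θ => g₂ θ * g₁ θ ^ d) ν := by
      refine hg₂.mul_bdd (c := M ^ d) (hg₁.pow_const d).aestronglyMeasurable ?_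
      filter_upwards [hg₁0, hg₁M] with θ h1 h2
      rw [Real.norm_of_nonneg (Real.rpow_nonneg h1 d)]
      gcongr
    have hae := (integral_eq_zero_iff_of_nonneg_ae hnn hint).1 hI.symm
    have hzero : ∀ x, ∫ θ, g₂ θ * expDivKernel x (g₁ θ) ∂ν = 0 := by
      intro x
      refine integral_eq_zero_of_ae ?_
      filter_upwards [hae, hg₁0] with θ hθ h1
      rcases mul_eq_zero.1 hθ with h | h
      · simp [h]
      · simp [expDivKernel, (Real.rpow_eq_zero h1 hd.ne').1 h]
    rw [← hI]
    simp only [hzero, integral_zero, mul_zero, zero_mul]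
    exact IsEquivalent.refl
  · have hc := mul_pos hΓ hI
    have hev := tendsto_one_div_atTop_nhdsGT_zero.eventually hF.eventually_pos
    rw [isEquivalent_iff_tendsto_div_of_pos (hev.mono fun s hs => mul_pos hc hs)]
    have := (tendsto_integral_mixture_div_rvCDF hX h0 hd hF hg₁ hg₁0 hM hg₁M hg₂).div_const
      (Real.Gamma (d + 1) * ∫ θ, g₂ θ * g₁ θ ^ d ∂ν)
    rw [div_self hc.ne'] at this
    refine this.congr fun s => ?_
    rw [div_div, mul_comm (rvCDF P X _)]

end ErrorRate

/-! ### The three combining schemes. -/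

section Combining

lemma combinedGain_egc_le_iff {Ω : Type*} {N : ℕ} {X : Fin N → Ω → ℝ} (hN : 0 < N) {x : ℝ} (hx : 0 < x) (ω : Ω) :
    combinedGain .egc X ω ≤ x ↔ ∑ n, Real.sqrt (X n ω) ≤ Real.sqrt (N * x) := by
  have hN' : (0 : ℝ) < N := Nat.cast_pos.2 hN
  have hS : 0 ≤ ∑ n, Real.sqrt (X n ω) := Finset.sum_nonneg fun n _ => Real.sqrt_nonneg _
  simp only [combinedGain, CombiningScheme.gain]
  rw [div_le_iff₀' hN', Real.le_sqrt hS]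
  positivity

variable {Ω : Type*} [MeasurableSpace Ω] {P : Measure Ω} {N : ℕ} {d : Fin N → ℝ}
  {X : Fin N → Ω → ℝ}

lemma combinedGain_nonneg (s : CombiningScheme) (h0 : ∀ n, ∀ᵐ ω ∂P, 0 ≤ X n ω) :
    ∀ᵐ ω ∂P, 0 ≤ combinedGain s X ω := by
  filter_upwards [ae_all_iff.2 h0] with ω hω
  cases s
  · exact Finset.sum_nonneg (s := Finset.univ) fun n _ => hω n
  · exact div_nonneg (sq_nonneg _) (Nat.cast_nonneg N)
  · exact Real.iSup_nonneg hω

variable [IsProbabilityMeasure P]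

/-- The CDF of a sum of independent nonnegative random variables whose CDFs are regularly
varying at `0`. -/
theorem isEquivalent_rvCDF_sum (hX : ∀ n, Measurable (X n)) (h0 : ∀ n, ∀ᵐ ω ∂P, 0 ≤ X n ω)
    (hind : iIndepFun X P) (hd : ∀ n, 0 < d n) (hdc : 0 < ∑ n, d n)
    (hF : ∀ n, HasVariationExponentAtZero (rvCDF P (X n)) (d n)) :
    rvCDF P (fun ω => ∑ n, X n ω) ~[𝓝[>] 0] fun x =>
      (Real.Gamma ((∑ n, d n) + 1))⁻¹ * (∏ n, Real.Gamma (d n + 1)) * ∏ n, rvCDF P (X n) x := by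
  set c : ℝ := (Real.Gamma ((∑ n, d n) + 1))⁻¹ * ∏ n, Real.Gamma (d n + 1) with hc
  have hΓ : 0 < Real.Gamma ((∑ n, d n) + 1) := Real.Gamma_pos_of_pos (by linarith)
  have hΓn : ∀ n, 0 < Real.Gamma (d n + 1) := fun n =>
    Real.Gamma_pos_of_pos (by linarith [hd n])
  have hΓp : 0 < ∏ n, Real.Gamma (d n + 1) := Finset.prod_pos fun n _ => hΓn n
  have hc0 : 0 < c := mul_pos (inv_pos.2 hΓ) hΓp
  have hRV := (HasVariationExponentAtZero.prod hF).const_mul hc0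
  have hS : Measurable fun ω => ∑ n, X n ω := Finset.measurable_fun_sum _ fun n _ => hX n
  have hS0 : ∀ᵐ ω ∂P, 0 ≤ ∑ n, X n ω := by
    filter_upwards [ae_all_iff.2 h0] with ω hω using Finset.sum_nonneg fun n _ => hω n
  have hlap : ∀ s : ℝ, ∫ ω, Real.exp (-(s * ∑ n, X n ω)) ∂P =
      ∏ n, ∫ ω, Real.exp (-(s * X n ω)) ∂P := by
    intro s
    have := hind.integral_fun_prod_comp (f := fun _ x => Real.exp (-(s * x)))
      (fun n => (hX n).aemeasurable)
      (fun n => (by fun_prop : Continuous fun x : ℝ => Real.exp (-(s * x))).aestronglyMeasurable)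
    rw [← this]
    simp only [← Real.exp_sum, Finset.mul_sum, Finset.sum_neg_distrib]
  have key := tendsto_rvCDF_div_of_tendsto_laplace hS hS0 hdc
    (φ := fun s => c * ∏ n, rvCDF P (X n) (1 / s))
    (tendsto_one_div_atTop_nhdsGT_zero.eventually hRV.eventually_pos) fun k => by
      have hk : (0 : ℝ) < 1 / (k + 1) := by positivity
      have h1 := (tendsto_finsetProd Finset.univ fun n _ =>
        tendsto_integral_exp_div_mul_div_rvCDF (hX n) (h0 n) (hd n) (hF n) hk).div_const c
      -- The constant `c` is chosen so that this quotient leaves exactly the `Γ(d_c + 1)` of the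
      -- Tauberian hypothesis.
      have e : (∏ n, Real.Gamma (d n + 1) * (1 / ((k : ℝ) + 1)) ^ d n) / c =
          Real.Gamma ((∑ n, d n) + 1) * (1 / (k + 1)) ^ ∑ n, d n := by
        rw [Finset.prod_mul_distrib, ← Real.rpow_sum_of_pos hk, hc]
        field_simp
      rw [e] at h1
      refine h1.congr fun s => ?_
      rw [hlap, Finset.prod_div_distrib, div_div, mul_comm c]
      simp only [div_div_eq_mul_div, div_one, mul_comm s]
  rw [isEquivalent_iff_tendsto_div_of_pos hRV.eventually_pos]
  refine (key.comp tendsto_inv_nhdsGT_zero).congr fun x => ?_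
  simp only [Function.comp, one_div, inv_inv]

lemma rvCDF_pos_of_forall_le_imp {x : ℝ} {Y : Ω → ℝ} (hX : ∀ n, Measurable (X n))
    (hY : Measurable Y) (hind : iIndepFun X P) {y : ℝ} (hpos : ∀ n, 0 < rvCDF P (X n) y)
    (h : ∀ ω, (∀ n, X n ω ≤ y) → Y ω ≤ x) : 0 < rvCDF P Y x := by
  have h1 := hind.measure_inter_preimage_eq_mul Finset.univ (sets := fun _ => Set.Iic y)
    fun _ _ => measurableSet_Iic
  have h2 : 0 < P.real (⋂ n ∈ Finset.univ, X n ⁻¹' Set.Iic y) := by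
    rw [measureReal_def, h1, ENNReal.toReal_prod]
    refine Finset.prod_pos fun n _ => ?_
    have := hpos n
    rwa [rvCDF_eq_measureReal (hX n)] at this
  rw [rvCDF_eq_measureReal hY]
  refine h2.trans_le (measureReal_mono fun ω hω => ?_)
  simp only [Finset.mem_univ, Set.iInter_true, Set.mem_iInter] at hω
  exact h ω hω

lemma rvCDF_iSup (hN : 0 < N) (hX : ∀ n, Measurable (X n)) (hind : iIndepFun X P) (x : ℝ) :
    rvCDF P (fun ω => ⨆ n, X n ω) x = ∏ n, rvCDF P (X n) x := by
  have : Nonempty (Fin N) := ⟨⟨0, hN⟩⟩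
  have h1 := hind.measure_inter_preimage_eq_mul Finset.univ (sets := fun _ => Set.Iic x)
    fun _ _ => measurableSet_Iic
  have h2 : {ω | ⨆ n, X n ω ≤ x} = ⋂ n ∈ Finset.univ, X n ⁻¹' Set.Iic x := by
    ext ω
    simp [ciSup_le_iff (Set.finite_range fun n => X n ω).bddAbove]
  rw [rvCDF_eq_measureReal (Measurable.iSup hX), h2, measureReal_def, h1, ENNReal.toReal_prod]
  exact Finset.prod_congr rfl fun n _ => (rvCDF_eq_measureReal (hX n) x).symm

lemma rvCDF_sqrt {Z : Ω → ℝ} (hZ : Measurable Z) {x : ℝ} (hx : 0 < x) :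
    rvCDF P (fun ω => Real.sqrt (Z ω)) x = rvCDF P Z (x ^ 2) := by
  rw [rvCDF_eq_measureReal hZ.sqrt, rvCDF_eq_measureReal hZ]
  simp only [Real.sqrt_le_left hx.le]

lemma measurable_combinedGain (s : CombiningScheme) (hX : ∀ n, Measurable (X n)) :
    Measurable (combinedGain s X) := by
  cases s
  · exact Finset.measurable_fun_sum Finset.univ fun n _ => hX n
  · exact ((Finset.measurable_fun_sum _ fun n _ => (hX n).sqrt).pow_const 2).div_const _
  · exact Measurable.iSup hX

lemma rvCDF_combinedGain_egc (hN : 0 < N) (hX : ∀ n, Measurable (X n)) {x : ℝ} (hx : 0 < x) :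
    rvCDF P (combinedGain .egc X) x =
      rvCDF P (fun ω => ∑ n, Real.sqrt (X n ω)) (Real.sqrt (N * x)) := by
  rw [rvCDF_eq_measureReal (measurable_combinedGain _ hX),
    rvCDF_eq_measureReal (Finset.measurable_fun_sum _ fun n _ => (hX n).sqrt)]
  simp only [combinedGain_egc_le_iff hN hx]

/-- Asymptotic equivalence gives positivity only near `0`, so all `x > 0` need this argument: by
independence all branches are small together with positive probability. The level `x / N` suffices
for MRC and EGC, `x` for SC. -/
lemma rvCDF_combinedGain_pos (s : CombiningScheme) (hN : 0 < N) (hX : ∀ n, Measurable (X n))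
    (hind : iIndepFun X P) (hpos : ∀ n x, 0 < x → 0 < rvCDF P (X n) x) {x : ℝ} (hx : 0 < x) :
    0 < rvCDF P (combinedGain s X) x := by
  have hN' : (0 : ℝ) < N := Nat.cast_pos.2 hN
  have hm := measurable_combinedGain s hX
  have : Nonempty (Fin N) := ⟨⟨0, hN⟩⟩
  cases s with
  | mrc =>
    refine rvCDF_pos_of_forall_le_imp hX hm hind (fun n => hpos n (x / N) (by positivity))
      fun ω hω => ?_
    refine (Finset.sum_le_sum (s := Finset.univ) fun n _ => hω n).trans_eq ?_
    simp only [Finset.sum_const, Finset.card_univ, Fintype.card_fin, nsmul_eq_mul]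
    field_simp
  | egc =>
    refine rvCDF_pos_of_forall_le_imp hX hm hind (fun n => hpos n (x / N) (by positivity))
      fun ω hω => ?_
    rw [combinedGain_egc_le_iff hN hx]
    refine (Finset.sum_le_sum fun n _ => Real.sqrt_le_sqrt (hω n)).trans_eq ?_
    simp only [Finset.sum_const, Finset.card_univ, Fintype.card_fin, nsmul_eq_mul]
    have : (N : ℝ) * x = N ^ 2 * (x / N) := by field_simp
    rw [this, Real.sqrt_mul (sq_nonneg _), Real.sqrt_sq hN'.le]
  | sc =>
    exact rvCDF_pos_of_forall_le_imp hX hm hind (fun n => hpos n x hx) fun ω hω => ciSup_le hω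

lemma hasVariationExponentAtZero_cdfNearZero (s : CombiningScheme) (hN : 0 < N)
    (hd : ∀ n, 0 < d n) (hdc : 0 < ∑ n, d n) {F : Fin N → ℝ → ℝ}
    (hF : ∀ n, HasVariationExponentAtZero (F n) (d n)) :
    HasVariationExponentAtZero (s.cdfNearZero d F) (∑ n, d n) := by
  cases s with
  | mrc =>
    refine (HasVariationExponentAtZero.prod hF).const_mul (mul_pos (inv_pos.2 ?_) ?_)
    · exact Real.Gamma_pos_of_pos (by linarith)
    · exact Finset.prod_pos fun n _ => Real.Gamma_pos_of_pos (by linarith [hd n])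
  | egc =>
    refine (HasVariationExponentAtZero.prod fun n =>
      (hF n).comp_const_mul (Nat.cast_pos.2 hN)).const_mul (mul_pos (inv_pos.2 ?_) ?_)
    · exact Real.Gamma_pos_of_pos (by linarith)
    · exact Finset.prod_pos fun n _ => Real.Gamma_pos_of_pos (by linarith [hd n])
  | sc => exact HasVariationExponentAtZero.prod hF

lemma tendsto_sqrt_const_mul_nhdsGT_zero {a : ℝ} (ha : 0 < a) :
    Tendsto (fun x : ℝ => Real.sqrt (a * x)) (𝓝[>] 0) (𝓝[>] 0) := by
  have hsqrt : Tendsto Real.sqrt (𝓝[>] 0) (𝓝[>] 0) := by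
    refine tendsto_nhdsWithin_iff.2 ⟨?_, ?_⟩
    · have := Real.continuous_sqrt.tendsto 0
      rw [Real.sqrt_zero] at this
      exact this.mono_left nhdsWithin_le_nhds
    · filter_upwards [self_mem_nhdsWithin] with x hx using Real.sqrt_pos.2 hx
  exact hsqrt.comp (tendsto_const_mul_nhdsGT_zero ha)

theorem isEquivalent_rvCDF_combinedGain (s : CombiningScheme) (hN : 0 < N)
    (hX : ∀ n, Measurable (X n)) (h0 : ∀ n, ∀ᵐ ω ∂P, 0 ≤ X n ω) (hind : iIndepFun X P)
    (hd : ∀ n, 0 < d n) (hdc : 0 < ∑ n, d n)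
    (hF : ∀ n, HasVariationExponentAtZero (rvCDF P (X n)) (d n)) :
    rvCDF P (combinedGain s X) ~[𝓝[>] 0] s.cdfNearZero d fun n => rvCDF P (X n) := by
  have hN' : (0 : ℝ) < N := Nat.cast_pos.2 hN
  cases s with
  | mrc => exact isEquivalent_rvCDF_sum hX h0 hind hd hdc hF
  | egc =>
    have hsum : ∑ n, 2 * d n = 2 * ∑ n, d n := (Finset.mul_sum _ _ _).symm
    -- The CDF of `√z_n` is `F_n(x²)`, of exponent `2 d_n`; substituting `√(N x)` then yields `F_n(N
    -- x)`.
    have h1 := isEquivalent_rvCDF_sum (d := fun n => 2 * d n) (fun n => (hX n).sqrt)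
      (fun n => Eventually.of_forall fun ω => Real.sqrt_nonneg _)
      (hind.comp (fun _ => Real.sqrt) fun _ => Real.continuous_sqrt.measurable)
      (fun n => mul_pos two_pos (hd n)) (by rw [hsum]; positivity)
      (fun n => (hF n).comp_sq.congr fun x hx => rvCDF_sqrt (hX n) hx)
    have h2 := h1.comp_tendsto (tendsto_sqrt_const_mul_nhdsGT_zero hN')
    refine (h2.congr_left ?_).congr_right ?_
    · filter_upwards [self_mem_nhdsWithin] with x hx
      exact (rvCDF_combinedGain_egc hN hX hx).symm
    · filter_upwards [self_mem_nhdsWithin] with x hx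
      have hx : 0 < x := hx
      have hNx : 0 < N * x := mul_pos hN' hx
      simp only [Function.comp, CombiningScheme.cdfNearZero, hsum]
      congr 1
      refine Finset.prod_congr rfl fun n _ => ?_
      exact (rvCDF_sqrt (hX n) (Real.sqrt_pos.2 hNx)).trans (by rw [Real.sq_sqrt hNx.le])
  | sc =>
    have : rvCDF P (combinedGain .sc X) =
        CombiningScheme.cdfNearZero d (fun n => rvCDF P (X n)) .sc :=
      funext fun x => rvCDF_iSup hN hX hind x
    rw [this]

end Combining

/-! ### Main theorem. -/

theorem mainTheorem7
    {Ω : Type*} [MeasurableSpace Ω] (P : Measure Ω) [IsProbabilityMeasure P]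
    -- independent, nonnegative branch power gains `z₁, …, z_N`
    (N : ℕ) (hN : 0 < N) (z : Fin N → Ω → ℝ)
    (hz_meas : ∀ n, Measurable (z n)) (hz_nonneg : ∀ n, ∀ᵐ ω ∂P, 0 ≤ z n ω)
    (hz_indep : iIndepFun z P)
    -- with CDFs `F_n(x) = x ^ d_n * l_n(x)`, where `l_n` is slowly varying at `0`
    (d : Fin N → ℝ) (hd : ∀ n, 0 < d n)
    (l : Fin N → ℝ → ℝ) (hl : ∀ n, SlowlyVaryingAtZero (l n))
    (hF : ∀ n, ∀ x, 0 < x → rvCDF P (z n) x = x ^ d n * l n x)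
    -- parameters of the exponential error rate
    (α β : ℝ) (hα : 0 < α) (hβ : 0 < β)
    -- parameters of the exponential-mixture error rate
    (θt : ℝ) (hθ_pos : 0 < θt) (hθ_lt : θt < Real.pi) (g₁ g₂ : ℝ → ℝ)
    (hg₁_meas : AEMeasurable g₁ (volume.restrict (Set.Ioo 0 θt)))
    (hg₁_nonneg : ∀ θ ∈ Set.Ioo 0 θt, 0 ≤ g₁ θ)
    (hg₁_bdd : BddAbove (g₁ '' Set.Ioo 0 θt))
    (hg₂_nonneg : ∀ θ ∈ Set.Ioo 0 θt, 0 ≤ g₂ θ)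
    (hg₂_int : IntegrableOn g₂ (Set.Ioo 0 θt) volume) :
    0 < ∑ n, d n ∧
    -- for selection combining the CDF formula is exact
    (∀ x, rvCDF P (combinedGain .sc z) x = ∏ n, rvCDF P (z n) x) ∧
    (∀ x, 0 < x → rvCDF P (combinedGain .sc z) x = x ^ (∑ n, d n) * ∏ n, l n x) ∧
    ∀ s : CombiningScheme,
      -- the combined CDF is regularly varying at `0` with exponent `d_c = ∑ d_n`
      HasVariationExponentAtZero (rvCDF P (combinedGain s z)) (∑ n, d n) ∧
      -- and is given near `0` by the formula of the scheme
      rvCDF P (combinedGain s z) ~[𝓝[>] 0] s.cdfNearZero d (fun n => rvCDF P (z n)) ∧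
      -- average of the exponential error rate, by the combined CDF and by its formula
      (fun ρ : ℝ => ∫ ω, β * Real.exp (-(α * ρ * combinedGain s z ω)) ∂P) ~[atTop]
        (fun ρ => β * Real.Gamma ((∑ n, d n) + 1) * rvCDF P (combinedGain s z) (1 / (α * ρ))) ∧
      (fun ρ : ℝ => ∫ ω, β * Real.exp (-(α * ρ * combinedGain s z ω)) ∂P) ~[atTop]
        (fun ρ => β * Real.Gamma ((∑ n, d n) + 1) *
          s.cdfNearZero d (fun n => rvCDF P (z n)) (1 / (α * ρ))) ∧
      -- average of the exponential-mixture error rate, by the combined CDF and by its formula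
      (fun ρ : ℝ => ∫ ω, mixtureErrorRate θt g₁ g₂ (ρ * combinedGain s z ω) ∂P) ~[atTop]
        (fun ρ => Real.Gamma ((∑ n, d n) + 1) *
          (∫ θ in Set.Ioo 0 θt, g₂ θ * g₁ θ ^ (∑ n, d n)) *
          rvCDF P (combinedGain s z) (1 / ρ)) ∧
      (fun ρ : ℝ => ∫ ω, mixtureErrorRate θt g₁ g₂ (ρ * combinedGain s z ω) ∂P) ~[atTop]
        (fun ρ => Real.Gamma ((∑ n, d n) + 1) *
          (∫ θ in Set.Ioo 0 θt, g₂ θ * g₁ θ ^ (∑ n, d n)) *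
          s.cdfNearZero d (fun n => rvCDF P (z n)) (1 / ρ)) := by
  have : Nonempty (Fin N) := ⟨⟨0, hN⟩⟩
  have hdc : 0 < ∑ n, d n := Finset.sum_pos (fun n _ => hd n) Finset.univ_nonempty
  have hRV : ∀ n, HasVariationExponentAtZero (rvCDF P (z n)) (d n) := fun n =>
    ((hl n).rpow_mul (d n)).congr (hF n)
  have hsc := rvCDF_iSup hN hz_meas hz_indep
  refine ⟨hdc, hsc, fun x hx => ?_, fun s => ?_⟩
  · refine (hsc x).trans ?_
    rw [Real.rpow_sum_of_pos hx, ← Finset.prod_mul_distrib]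
    exact Finset.prod_congr rfl fun n _ => hF n x hx
  have hZ := measurable_combinedGain s hz_meas
  have hZ0 := combinedGain_nonneg s hz_nonneg
  have hequiv := isEquivalent_rvCDF_combinedGain s hN hz_meas hz_nonneg hz_indep hd hdc hRV
  have hZRV : HasVariationExponentAtZero (rvCDF P (combinedGain s z)) (∑ n, d n) :=
    (hasVariationExponentAtZero_cdfNearZero s hN hd hdc hRV).of_isEquivalent
      (fun x hx => rvCDF_combinedGain_pos s hN hz_meas hz_indep (fun n => (hRV n).1) hx) hequiv
  have hexp := isEquivalent_integral_exp (β := β) hZ hZ0 hdc hZRV hα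
  have hmem : ∀ {p : ℝ → Prop}, (∀ θ ∈ Set.Ioo 0 θt, p θ) →
      ∀ᵐ θ ∂volume.restrict (Set.Ioo 0 θt), p θ := fun h =>
    (ae_restrict_iff' measurableSet_Ioo).2 (Eventually.of_forall h)
  obtain ⟨M, hM⟩ := hg₁_bdd
  have hmix : (fun ρ : ℝ => ∫ ω, mixtureErrorRate θt g₁ g₂ (ρ * combinedGain s z ω) ∂P) ~[atTop]
      fun ρ => Real.Gamma ((∑ n, d n) + 1) *
        (∫ θ in Set.Ioo 0 θt, g₂ θ * g₁ θ ^ (∑ n, d n)) * rvCDF P (combinedGain s z) (1 / ρ) :=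
    -- The maximum with `1` makes the bound on `g₁` strictly positive, as division by it requires.
    isEquivalent_integral_mixture (M := max M 1) hZ hZ0 hdc hZRV hg₁_meas (hmem hg₁_nonneg)
      (zero_lt_one.trans_le (le_max_right _ _))
      (hmem fun θ hθ => (hM (Set.mem_image_of_mem g₁ hθ)).trans (le_max_left _ _))
      hg₂_int (hmem hg₂_nonneg)
  refine ⟨hZRV, hequiv, hexp, hexp.trans ?_, hmix, hmix.trans ?_⟩
  · exact IsEquivalent.refl.mul (hequiv.comp_tendsto (tendsto_one_div_mul_atTop_nhdsGT_zero hα))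
  · exact IsEquivalent.refl.mul (hequiv.comp_tendsto tendsto_one_div_atTop_nhdsGT_zero)
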